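/- Wythoff's moves are the pairs $(i,0)$, $(0,i)$ and $(i,i)$ with $i>0$. For $\ell\in\mathbb{N}$, let $K^\ell$ be the following two-player game. Positions are pairs $(x,y)\in\mathbb{N}^2$; the positions with $x+y\le \ell$ are terminal (no move can be played from them); from a non-terminal position $(x,y)$ a player may play any Wythoff move $(a,b)$ with $a\le x$ and $b\le y$, reaching $(x-a,y-b)$. A player who is unable to move loses. A position is a $\mathcal{P}$-position if no legal move from it leads to a $\mathcal{P}$-position, and an $\mathcal{N}$-position otherwise; a winning move is a legal move leading to a $\mathcal{P}$-position. A move $m$ of the rule-set is redundant if removing $m$ from the rule-set (keeping the same terminal positions) does not change the set of $\mathcal{P}$-positions. Theorem. Let $\ell\in\{1,2,3,4\}$. The game $K^\ell$ has no redundant move: removing any single Wythoff move $m$ from the rule-set changes the set of $\mathcal{P}$-positions. Moreover, for every Wythoff move $m$ there exists an $\mathcal{N}$-position of $K^\ell$ whose only winning move is $m$. -/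

import Mathlib

/-- An impartial take-away game played on two piles of tokens. A position is a pair `(x, y)` of
pile sizes, and a move `m = (i, j)` of the rule-set removes `i` tokens from the first pile and `j`
tokens from the second one. Passing is not allowed, and the play stops as soon as a
position of `terminal` is reached. -/
structure TakeAwayGame where
  /-- The rule-set. -/
  moves : Set (ℕ × ℕ)
  /-- The positions declared to be terminal. -/
  terminal : Set (ℕ × ℕ)
  /-- There is no pass. -/
  zero_notMem_moves : (0, 0) ∉ moves

namespace TakeAwayGame

/-- The move `m` can be played from the position `p`. -/
def IsLegal (G : TakeAwayGame) (p m : ℕ × ℕ) : Prop :=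
  p ∉ G.terminal ∧ m ∈ G.moves ∧ m.1 ≤ p.1 ∧ m.2 ≤ p.2

/-- The position reached from `p` by playing the move `m` (used for legal moves only). -/
def play (p m : ℕ × ℕ) : ℕ × ℕ := (p.1 - m.1, p.2 - m.2)

theorem IsLegal.play_lt {G : TakeAwayGame} {p m : ℕ × ℕ} (h : G.IsLegal p m) :
    (play p m).1 + (play p m).2 < p.1 + p.2 := by
  obtain ⟨_, hm, h1, h2⟩ := h
  have hne : ¬ (m.1 = 0 ∧ m.2 = 0) := by
    rintro ⟨ha, hb⟩
    apply G.zero_notMem_moves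
    have : m = (0, 0) := Prod.ext ha hb
    rwa [this] at hm
  simp only [play]
  omega

/-- The P-positions (normal convention: a player who cannot move loses): no
legal move leads to a P-position. In particular, a position without
legal moves is a P-position. -/
def IsPPosition (G : TakeAwayGame) (p : ℕ × ℕ) : Prop :=
  ∀ m : ℕ × ℕ, G.IsLegal p m → ¬ G.IsPPosition (play p m)
termination_by p.1 + p.2
decreasing_by
  rename_i h
  exact h.play_lt

theorem isPPosition_iff (G : TakeAwayGame) (p : ℕ × ℕ) :
    G.IsPPosition p ↔ ∀ m : ℕ × ℕ, G.IsLegal p m → ¬ G.IsPPosition (play p m) := by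
  rw [IsPPosition]

/-- The N-positions: those that are not P-positions. -/
def IsNPosition (G : TakeAwayGame) (p : ℕ × ℕ) : Prop := ¬ G.IsPPosition p

/-- The set of P-positions. -/
def pPositions (G : TakeAwayGame) : Set (ℕ × ℕ) := {p | G.IsPPosition p}

/-- A winning move from `p`: a legal move leading to a P-position. -/
def IsWinningMove (G : TakeAwayGame) (p m : ℕ × ℕ) : Prop :=
  G.IsLegal p m ∧ G.IsPPosition (play p m)

/-- The game obtained by removing the move `m` from the rule-set; the terminal
positions are unchanged. -/
def removeMove (G : TakeAwayGame) (m : ℕ × ℕ) : TakeAwayGame where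
  moves := G.moves \ {m}
  terminal := G.terminal
  zero_notMem_moves := fun h => G.zero_notMem_moves h.1

/-- A move of `G` is redundant if removing it from the rule-set does not change the set of
P-positions. -/
def IsRedundant (G : TakeAwayGame) (m : ℕ × ℕ) : Prop :=
  m ∈ G.moves ∧ (G.removeMove m).pPositions = G.pPositions

end TakeAwayGame

/-- The moves of Wythoff's game: `(i, 0)`, `(0, i)` and `(i, i)` with `i > 0`. -/
def wythoffMoves : Set (ℕ × ℕ) :=
  {m | ∃ i : ℕ, 0 < i ∧ (m = (i, 0) ∨ m = (0, i) ∨ m = (i, i))}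

/-- The game `K^ℓ`: Wythoff's moves, and the terminal positions are the `(x, y)` with
`x + y ≤ ℓ`. -/
def gameK (ℓ : ℕ) : TakeAwayGame where
  moves := wythoffMoves
  terminal := {p | p.1 + p.2 ≤ ℓ}
  zero_notMem_moves := by
    rintro ⟨i, hi, h | h | h⟩ <;> simp only [Prod.mk.injEq] at h <;> omega

/-! It suffices to find, for each move, a position where it is the only winning move: were the move
redundant, that position would become P after its removal while the P-set stayed the same. The
nonterminal P-positions are Wythoff-like pairs: their entries, shifted by `ℓ + 1`, partition ℕ into
small and large ones, and the differences are `ℓ + 1, ℓ + 2, …` in turn. A horizontal or vertical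
move is isolated next to the first pair. A diagonal move `(k, k)` is isolated by translating a pair
by `k` so that both entries become small (`exists_small_add_small`). Such a pair comes from the
substitution small ↦ large small, large ↦ small, which fixes the structure of the word of entries
and yields arbitrarily long factors that differ only in their first two letters. -/

/-- The non-terminal P-positions of `K^ℓ` are, up to symmetry, the pairs `(a, b)` in which `a` is a
small entry and `b` the matching large one. `LargeEntry ℓ j` says that `j + ℓ + 1` is the large
entry of its pair. The pair of the small entry `i + ℓ + 1` has difference `ℓ + 1 + n`, where `n` is
the number of smaller small entries. -/
def LargeEntry (ℓ j : ℕ) : Prop :=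
  ∃ i, ∃ _ : i < j, ¬ LargeEntry ℓ i ∧
    i + (ℓ + 1) + Nat.card {t : Fin i // ¬ LargeEntry ℓ t.1} = j
termination_by j
decreasing_by
  · assumption
  · exact t.2.trans (by assumption)

/-- `j + ℓ + 1` is the small entry of its pair. -/
def SmallEntry (ℓ j : ℕ) : Prop := ¬ LargeEntry ℓ j

/-- The number of small entries before the index `i`. -/
noncomputable def smallCount (ℓ i : ℕ) : ℕ := Nat.card {t : Fin i // SmallEntry ℓ t.1}

/-- The index of the large entry that matches the small entry of index `i`. -/
noncomputable def partner (ℓ i : ℕ) : ℕ := i + (ℓ + 1) + smallCount ℓ i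

/-! ### Small and large entries -/

theorem smallCount_eq_count (ℓ i : ℕ) [DecidablePred (SmallEntry ℓ)] :
    smallCount ℓ i = Nat.count (SmallEntry ℓ) i := by
  let := Nat.CountSet.fintype (SmallEntry ℓ) i
  rw [smallCount, Nat.count_eq_card_fintype, ← Nat.card_eq_fintype_card]
  exact Nat.card_congr
    { toFun := fun t => ⟨t.1.1, t.1.2, t.2⟩
      invFun := fun t => ⟨⟨t.1, t.2.1⟩, t.2.2⟩
      left_inv := fun _ => rfl
      right_inv := fun _ => rfl }

theorem smallCount_succ_of_small {ℓ i : ℕ} (h : SmallEntry ℓ i) :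
    smallCount ℓ (i + 1) = smallCount ℓ i + 1 := by
  classical
  simp [smallCount_eq_count, Nat.count_succ, h]

theorem smallCount_succ_of_not_small {ℓ i : ℕ} (h : ¬ SmallEntry ℓ i) :
    smallCount ℓ (i + 1) = smallCount ℓ i := by
  classical
  simp [smallCount_eq_count, Nat.count_succ, h]

theorem smallCount_lt_of_lt {ℓ i j : ℕ} (h : SmallEntry ℓ i) (hij : i < j) :
    smallCount ℓ i < smallCount ℓ j := by
  classical
  simpa [smallCount_eq_count] using Nat.count_strict_mono h hij

theorem exists_smallCount_eq {ℓ i n : ℕ} (hn : n < smallCount ℓ i) :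
    ∃ k < i, SmallEntry ℓ k ∧ smallCount ℓ k = n := by
  induction i with
  | zero => simp [smallCount] at hn
  | succ i ih =>
    by_cases hs : SmallEntry ℓ i
    · rw [smallCount_succ_of_small hs] at hn
      rcases Nat.lt_succ_iff_lt_or_eq.mp hn with h | h
      · obtain ⟨k, hk, h⟩ := ih h
        exact ⟨k, hk.trans (Nat.lt_succ_self i), h⟩
      · exact ⟨i, Nat.lt_succ_self i, hs, h.symm⟩
    · rw [smallCount_succ_of_not_small hs] at hn
      obtain ⟨k, hk, h⟩ := ih hn
      exact ⟨k, hk.trans (Nat.lt_succ_self i), h⟩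

theorem largeEntry_iff {ℓ j : ℕ} :
    LargeEntry ℓ j ↔ ∃ i, SmallEntry ℓ i ∧ partner ℓ i = j := by
  rw [LargeEntry]
  constructor
  · rintro ⟨i, _, hi, h⟩
    exact ⟨i, hi, h⟩
  · rintro ⟨i, hi, h⟩
    exact ⟨i, by unfold partner at h; omega, hi, h⟩

theorem partner_succ_of_small {ℓ i : ℕ} (h : SmallEntry ℓ i) :
    partner ℓ (i + 1) = partner ℓ i + 2 := by
  simp only [partner, smallCount_succ_of_small h]
  omega

theorem partner_succ_of_not_small {ℓ i : ℕ} (h : ¬ SmallEntry ℓ i) :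
    partner ℓ (i + 1) = partner ℓ i + 1 := by
  simp only [partner, smallCount_succ_of_not_small h]
  omega

theorem partner_strictMono (ℓ : ℕ) : StrictMono (partner ℓ) :=
  strictMono_nat_of_lt_succ fun i => by
    by_cases h : SmallEntry ℓ i
    · rw [partner_succ_of_small h]; omega
    · rw [partner_succ_of_not_small h]; omega

theorem partner_add_le (ℓ i k : ℕ) : partner ℓ i + k ≤ partner ℓ (i + k) := by
  induction k with
  | zero => simp
  | succ k ih =>
    have : partner ℓ (i + k) < partner ℓ (i + (k + 1)) := partner_strictMono ℓ (by omega)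
    omega

theorem add_lt_partner (ℓ i : ℕ) : i + ℓ < partner ℓ i := by
  unfold partner; omega

theorem SmallEntry.not_small_partner {ℓ i : ℕ} (h : SmallEntry ℓ i) :
    ¬ SmallEntry ℓ (partner ℓ i) :=
  fun h' => h' (largeEntry_iff.mpr ⟨i, h, rfl⟩)

/-- `partner` jumps by 2 after a small index, so it skips this value. -/
theorem SmallEntry.small_partner_add_one {ℓ i : ℕ} (h : SmallEntry ℓ i) :
    SmallEntry ℓ (partner ℓ i + 1) := by
  intro hl
  obtain ⟨k, -, hk⟩ := largeEntry_iff.mp hl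
  have h1 : i < k := (partner_strictMono ℓ).lt_iff_lt.mp (by omega)
  have h2 : k < i + 1 := (partner_strictMono ℓ).lt_iff_lt.mp (by
    rw [partner_succ_of_small h]; omega)
  omega

theorem small_partner_of_not_small {ℓ i : ℕ} (h : ¬ SmallEntry ℓ i) :
    SmallEntry ℓ (partner ℓ i) := by
  intro hl
  obtain ⟨k, hs, hk⟩ := largeEntry_iff.mp hl
  exact h ((partner_strictMono ℓ).injective hk ▸ hs)

theorem smallEntry_of_le {ℓ i : ℕ} (h : i ≤ ℓ) : SmallEntry ℓ i := by
  intro hl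
  obtain ⟨k, -, hk⟩ := largeEntry_iff.mp hl
  have := add_lt_partner ℓ k
  omega

theorem partner_zero (ℓ : ℕ) : partner ℓ 0 = ℓ + 1 := by
  simp [partner, smallCount]

theorem smallEntry_succ_of_not_small {ℓ i : ℕ} (h : ¬ SmallEntry ℓ i) :
    SmallEntry ℓ (i + 1) := by
  obtain ⟨k, hs, rfl⟩ := largeEntry_iff.mp (not_not.mp h)
  exact hs.small_partner_add_one

/-! ### Twin factors of the word of entries -/

/-- The words of small and large entries read from `x` and from `y` begin with small-large and
large-small respectively, and agree from index `2` up to `m`. -/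
structure TwinWords (ℓ x y m : ℕ) : Prop where
  left_zero : SmallEntry ℓ x
  left_one : ¬ SmallEntry ℓ (x + 1)
  right_zero : ¬ SmallEntry ℓ y
  right_one : SmallEntry ℓ (y + 1)
  agree : ∀ i, 2 ≤ i → i < m → (SmallEntry ℓ (x + i) ↔ SmallEntry ℓ (y + i))

theorem TwinWords.mono {ℓ x y m n : ℕ} (h : TwinWords ℓ x y n) (hmn : m ≤ n) :
    TwinWords ℓ x y m :=
  { h with agree := fun i hi hi' => h.agree i hi (hi'.trans_le hmn) }

theorem TwinWords.partner_add_two {ℓ x y m : ℕ} (h : TwinWords ℓ x y m) :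
    partner ℓ (x + 2) = partner ℓ x + 3 ∧ partner ℓ (y + 2) = partner ℓ y + 3 := by
  have h1 := partner_succ_of_small h.left_zero
  have h2 := partner_succ_of_not_small h.left_one
  have h3 := partner_succ_of_not_small h.right_zero
  have h4 := partner_succ_of_small h.right_one
  simp only [add_assoc, Nat.reduceAdd] at h2 h4
  omega

/-- The word at `partner ℓ x` is the substitution image of the word at `x`. Both two-letter prefixes
have images of length 3 ending in small, and equal letters have equal images, so agreement lasts up
to `M`, the length of the image. -/
theorem TwinWords.agree_partner {ℓ x y m : ℕ} (h : TwinWords ℓ x y m) (hm : 2 ≤ m) :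
    ∃ M, m + 1 ≤ M ∧ partner ℓ (x + m) = partner ℓ x + M ∧
      partner ℓ (y + m) = partner ℓ y + M ∧
      ∀ j, 2 ≤ j → j < M → (SmallEntry ℓ (partner ℓ y + j) ↔ SmallEntry ℓ (partner ℓ x + j)) := by
  induction m, hm using Nat.le_induction with
  | base =>
    obtain ⟨h1, h2⟩ := h.partner_add_two
    refine ⟨3, le_rfl, h1, h2, fun j hj hj' => ?_⟩
    obtain rfl : j = 2 := by omega
    have hx := small_partner_of_not_small h.left_one
    rw [partner_succ_of_small h.left_zero] at hx
    have hy := h.right_one.small_partner_add_one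
    rw [partner_succ_of_not_small h.right_zero] at hy
    exact ⟨fun _ => hx, fun _ => hy⟩
  | succ m hm ih =>
    obtain ⟨M, hM, hx, hy, ha⟩ :=
      ih (h.mono (Nat.le_succ m))
    have hxy := h.agree m hm (Nat.lt_succ_self m)
    by_cases hs : SmallEntry ℓ (x + m)
    · have hs' := hxy.mp hs
      refine ⟨M + 2, by omega, ?_, ?_, fun j hj hj' => ?_⟩
      · rw [← add_assoc, partner_succ_of_small hs, hx, add_assoc]
      · rw [← add_assoc, partner_succ_of_small hs', hy, add_assoc]
      · have a1 := hs.not_small_partner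
        have a2 := hs.small_partner_add_one
        have b1 := hs'.not_small_partner
        have b2 := hs'.small_partner_add_one
        rw [hx] at a1 a2
        rw [hy] at b1 b2
        rcases lt_trichotomy j M with hjM | rfl | hjM
        · exact ha j hj hjM
        · exact iff_of_false b1 a1
        · obtain rfl : j = M + 1 := by omega
          exact iff_of_true b2 a2
    · have hs' := fun h' => hs (hxy.mpr h')
      refine ⟨M + 1, by omega, ?_, ?_, fun j hj hj' => ?_⟩
      · rw [← add_assoc, partner_succ_of_not_small hs, hx, add_assoc]
      · rw [← add_assoc, partner_succ_of_not_small hs', hy, add_assoc]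
      · have a1 := small_partner_of_not_small hs
        have b1 := small_partner_of_not_small hs'
        rw [hx] at a1
        rw [hy] at b1
        rcases (Nat.lt_succ_iff_lt_or_eq.mp hj') with hjM | rfl
        · exact ha j hj hjM
        · exact iff_of_true b1 a1

theorem TwinWords.partner {ℓ x y m : ℕ} (h : TwinWords ℓ x y m) (hm : 2 ≤ m) :
    TwinWords ℓ (partner ℓ y) (partner ℓ x) (m + 1) where
  left_zero := small_partner_of_not_small h.right_zero
  left_one := by
    have := h.right_one.not_small_partner
    rwa [partner_succ_of_not_small h.right_zero] at this
  right_zero := h.left_zero.not_small_partner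
  right_one := h.left_zero.small_partner_add_one
  agree := by
    obtain ⟨M, hM, -, -, ha⟩ := h.agree_partner hm
    exact fun i hi hi' => ha i hi (hi'.trans_le hM)

theorem exists_twinWords (ℓ m : ℕ) : ∃ x, TwinWords ℓ x (partner ℓ x) (m + 2) := by
  induction m with
  | zero =>
    -- Indices up to `ℓ` are small and `ℓ + 1 = partner ℓ 0` is the first large one.
    have hs := smallEntry_of_le (le_refl ℓ)
    refine ⟨ℓ, hs, ?_, hs.not_small_partner, hs.small_partner_add_one, fun i hi hi' => by omega⟩
    rw [← partner_zero ℓ]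
    exact (smallEntry_of_le (Nat.zero_le ℓ)).not_small_partner
  | succ m ih =>
    obtain ⟨x, hx⟩ := ih
    -- Each substitution swaps the roles of the two words; two of them restore the form `(x, partner
    -- ℓ x)`, now at `partner ℓ (partner ℓ x)`.
    exact ⟨_, ((hx.partner (by omega)).partner (by omega)).mono (by omega)⟩

/-- Every `k > 0` translates some pair to two small entries. -/
theorem exists_small_add_small {ℓ k : ℕ} (hk : 0 < k) :
    ∃ i, SmallEntry ℓ i ∧ SmallEntry ℓ (i + k) ∧ SmallEntry ℓ (partner ℓ i + k) := by
  obtain ⟨x, hx⟩ := exists_twinWords ℓ k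
  have hy := hx.partner (by omega)
  set y := partner ℓ x with hy_def
  have hshift : partner ℓ (y + 1) = partner ℓ y + 1 := partner_succ_of_not_small hx.right_zero
  -- If this entry is small, the pair of `y + 1` works; otherwise `y + k` is small, as large entries
  -- are isolated, and the pair `(x, y)` works.
  by_cases hs : SmallEntry ℓ (y + (k + 1))
  · refine ⟨y + 1, hx.right_one, ?_, ?_⟩
    · rwa [add_assoc, add_comm 1 k]
    · rw [hshift, add_assoc, add_comm 1 k]
      exact (hy.agree (k + 1) (by omega) (by omega)).mpr hs
  · have hk2 : 2 ≤ k := by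
      by_contra hlt
      obtain rfl : k = 1 := by omega
      apply hs
      have := small_partner_of_not_small hx.left_one
      rwa [partner_succ_of_small hx.left_zero] at this
    have hsk : SmallEntry ℓ (y + k) := by
      by_contra hns
      exact hs (smallEntry_succ_of_not_small hns)
    exact ⟨x, hx.left_zero, (hx.agree k hk2 (by omega)).mpr hsk, hsk⟩

/-! ### Determination of the P-positions -/

/-- The explicit description of the P-positions of `K^ℓ`. -/
def coldPositions (ℓ : ℕ) : Set (ℕ × ℕ) :=
  {p | p.1 + p.2 ≤ ℓ ∨ ∃ i, SmallEntry ℓ i ∧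
    (p.1 = i + (ℓ + 1) ∧ p.2 = partner ℓ i + (ℓ + 1) ∨
      p.2 = i + (ℓ + 1) ∧ p.1 = partner ℓ i + (ℓ + 1))}

theorem swap_mem_coldPositions {ℓ : ℕ} {p : ℕ × ℕ} :
    p.swap ∈ coldPositions ℓ ↔ p ∈ coldPositions ℓ := by
  simp only [coldPositions, Set.mem_ofPred_eq, Prod.fst_swap, Prod.snd_swap, add_comm p.2 p.1]
  simp only [or_comm]

theorem swap_mem_wythoffMoves {m : ℕ × ℕ} : m.swap ∈ wythoffMoves ↔ m ∈ wythoffMoves := by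
  obtain ⟨a, b⟩ := m
  simp only [wythoffMoves, Set.mem_ofPred_eq, Prod.swap_prod_mk, Prod.mk.injEq]
  refine exists_congr fun i => and_congr_right fun _ => ?_
  tauto

open TakeAwayGame in
theorem isLegal_swap_iff {ℓ : ℕ} {p m : ℕ × ℕ} :
    (gameK ℓ).IsLegal p.swap m.swap ↔ (gameK ℓ).IsLegal p m := by
  simp only [IsLegal, gameK, swap_mem_wythoffMoves, Set.mem_ofPred_eq, Prod.fst_swap, Prod.snd_swap,
    add_comm p.2 p.1, and_comm (a := m.2 ≤ p.2)]

/-- The difference of a pair is `ℓ + 1` plus its rank among the small entries. -/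
theorem partner_eq_of_diff_eq {ℓ i k : ℕ} (hi : SmallEntry ℓ i) (hk : SmallEntry ℓ k)
    (h : partner ℓ k + i = partner ℓ i + k) : k = i := by
  have h' : smallCount ℓ k = smallCount ℓ i := by unfold partner at h; omega
  rcases lt_trichotomy k i with hlt | rfl | hlt
  · have := smallCount_lt_of_lt hk hlt; omega
  · rfl
  · have := smallCount_lt_of_lt hi hlt; omega

theorem play_notMem_coldPositions_of_small {ℓ i : ℕ} {m : ℕ × ℕ} (hi : SmallEntry ℓ i)
    (h : (gameK ℓ).IsLegal (i + (ℓ + 1), partner ℓ i + (ℓ + 1)) m) :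
    TakeAwayGame.play (i + (ℓ + 1), partner ℓ i + (ℓ + 1)) m ∉ coldPositions ℓ := by
  obtain ⟨-, ⟨t, ht, hm⟩, h1, h2⟩ := h
  have hp := add_lt_partner ℓ i
  rintro (hq | ⟨k, hk, ⟨hq1, hq2⟩ | ⟨hq1, hq2⟩⟩) <;> rcases hm with rfl | rfl | rfl <;>
    simp only [TakeAwayGame.play] at *
  · omega
  · omega
  · omega
  · have := (partner_strictMono ℓ).injective (show partner ℓ k = partner ℓ i by omega)
    omega
  · obtain rfl : k = i := by omega
    omega
  · have := partner_eq_of_diff_eq hi hk (by omega)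
    omega
  · obtain rfl : k = partner ℓ i := by omega
    exact hi.not_small_partner hk
  · obtain rfl : i = partner ℓ k := by omega
    exact hk.not_small_partner hi
  · have := add_lt_partner ℓ k
    omega

theorem play_notMem_coldPositions {ℓ : ℕ} {p m : ℕ × ℕ} (hp : p ∈ coldPositions ℓ)
    (h : (gameK ℓ).IsLegal p m) : TakeAwayGame.play p m ∉ coldPositions ℓ := by
  obtain ⟨x, y⟩ := p
  rcases hp with hp | ⟨i, hi, ⟨rfl, rfl⟩ | ⟨hx, hy⟩⟩
  · exact absurd hp h.1
  · exact play_notMem_coldPositions_of_small hi h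
  · simp only at hx hy
    subst hx hy
    rw [← swap_mem_coldPositions]
    exact play_notMem_coldPositions_of_small hi (isLegal_swap_iff.mpr h)

theorem exists_play_mem_coldPositions_of_le {ℓ x y : ℕ} (hxy : x ≤ y)
    (hp : (x, y) ∉ coldPositions ℓ) :
    ∃ m, (gameK ℓ).IsLegal (x, y) m ∧ TakeAwayGame.play (x, y) m ∈ coldPositions ℓ := by
  have hterm : ¬ x + y ≤ ℓ := fun h => hp (Or.inl h)
  have vertical : ∀ z < y, (x, z) ∈ coldPositions ℓ →
      ∃ m, (gameK ℓ).IsLegal (x, y) m ∧ TakeAwayGame.play (x, y) m ∈ coldPositions ℓ := by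
    intro z hz h
    refine ⟨(0, y - z), ⟨hterm, ⟨y - z, by omega, by simp⟩, by simp, by simp⟩, ?_⟩
    simpa [TakeAwayGame.play, Nat.sub_sub_self hz.le] using h
  have diagonal : ∀ t, 0 < t → t ≤ x → (x - t, y - t) ∈ coldPositions ℓ →
      ∃ m, (gameK ℓ).IsLegal (x, y) m ∧ TakeAwayGame.play (x, y) m ∈ coldPositions ℓ :=
    fun t ht htx h => ⟨(t, t), ⟨hterm, ⟨t, ht, by simp⟩, htx, htx.trans hxy⟩, h⟩
  rcases Nat.lt_or_ge ℓ x with hx | hx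
  · obtain ⟨i, rfl⟩ : ∃ i, x = i + (ℓ + 1) := ⟨x - (ℓ + 1), by omega⟩
    by_cases hi : SmallEntry ℓ i
    · rcases lt_trichotomy y (partner ℓ i + (ℓ + 1)) with hy | rfl | hy
      -- A difference at most `ℓ` leads diagonally to a terminal `(0, d)`; a larger one, still below
      -- that of pair `i`, belongs to an earlier pair.
      · by_cases hd : y - (i + (ℓ + 1)) ≤ ℓ
        · exact diagonal (i + (ℓ + 1)) (by omega) le_rfl (Or.inl (by simp only; omega))
        · obtain ⟨k, hki, hk, hc⟩ := exists_smallCount_eq (ℓ := ℓ) (i := i)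
            (n := y - (i + (ℓ + 1)) - (ℓ + 1)) (by unfold partner at hy; omega)
          refine diagonal (i - k) (by omega) (by omega) (Or.inr ⟨k, hk, Or.inl ⟨?_, ?_⟩⟩)
          · simp only; omega
          · simp only [partner]; omega
      · exact absurd (Or.inr ⟨i, hi, Or.inl ⟨rfl, rfl⟩⟩) hp
      · exact vertical _ hy (Or.inr ⟨i, hi, Or.inl ⟨rfl, rfl⟩⟩)
    · obtain ⟨k, hk, rfl⟩ := largeEntry_iff.mp (not_not.mp hi)
      have := add_lt_partner ℓ k
      exact vertical (k + (ℓ + 1)) (by omega) (Or.inr ⟨k, hk, Or.inr ⟨rfl, rfl⟩⟩)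
  · exact vertical (ℓ - x) (by omega) (Or.inl (by simp only; omega))

theorem exists_play_mem_coldPositions {ℓ : ℕ} {p : ℕ × ℕ} (hp : p ∉ coldPositions ℓ) :
    ∃ m, (gameK ℓ).IsLegal p m ∧ TakeAwayGame.play p m ∈ coldPositions ℓ := by
  rcases le_total p.1 p.2 with h | h
  · exact exists_play_mem_coldPositions_of_le h hp
  · obtain ⟨m, hm, hq⟩ := exists_play_mem_coldPositions_of_le (ℓ := ℓ) h
      (fun h' => hp (swap_mem_coldPositions.mp h'))
    exact ⟨m.swap, isLegal_swap_iff.mp hm, swap_mem_coldPositions.mp hq⟩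

theorem isPPosition_iff_mem_coldPositions {ℓ : ℕ} (p : ℕ × ℕ) :
    (gameK ℓ).IsPPosition p ↔ p ∈ coldPositions ℓ := by
  induction hn : p.1 + p.2 using Nat.strong_induction_on generalizing p with
  | _ n ih =>
    subst hn
    rw [TakeAwayGame.isPPosition_iff]
    constructor
    · intro h
      by_contra hp
      obtain ⟨m, hm, hq⟩ := exists_play_mem_coldPositions hp
      exact h m hm ((ih _ hm.play_lt _ rfl).mpr hq)
    · intro hp m hm hq
      exact play_notMem_coldPositions hp hm ((ih _ hm.play_lt _ rfl).mp hq)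

theorem isWinningMove_iff {ℓ : ℕ} {p m : ℕ × ℕ} :
    (gameK ℓ).IsWinningMove p m ↔
      (gameK ℓ).IsLegal p m ∧ TakeAwayGame.play p m ∈ coldPositions ℓ := by
  rw [TakeAwayGame.IsWinningMove, isPPosition_iff_mem_coldPositions]

theorem isWinningMove_swap_iff {ℓ : ℕ} {p m : ℕ × ℕ} :
    (gameK ℓ).IsWinningMove p.swap m.swap ↔ (gameK ℓ).IsWinningMove p m := by
  rw [isWinningMove_iff, isWinningMove_iff, isLegal_swap_iff,
    show TakeAwayGame.play p.swap m.swap = (TakeAwayGame.play p m).swap from rfl,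
    swap_mem_coldPositions]

/-! ### Positions with a unique winning move -/

/-- The target is the first pair. Any other type of move makes the second entry at most `ℓ` while
the sum stays above `ℓ`, so it reaches no P-position. -/
theorem isWinningMove_horizontal_iff {ℓ k : ℕ} (hk : 0 < k) (m : ℕ × ℕ) :
    (gameK ℓ).IsWinningMove (2 * (ℓ + 1) + k, ℓ + 1) m ↔ m = (k, 0) := by
  have hzero := partner_zero ℓ
  rw [isWinningMove_iff]
  constructor
  · rintro ⟨⟨-, ⟨t, ht, hm⟩, h1, h2⟩, hq | ⟨c, hc, ⟨hq1, hq2⟩ | ⟨hq1, hq2⟩⟩⟩ <;>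
      try have hltc := add_lt_partner ℓ c
    all_goals rcases hm with rfl | rfl | rfl <;> simp only [TakeAwayGame.play] at *
    · omega
    · omega
    · omega
    · omega
    · omega
    · omega
    · obtain rfl : c = 0 := by omega
      rw [Prod.mk.injEq]
      omega
    · omega
    · omega
  · rintro rfl
    refine ⟨⟨fun h => ?_, ⟨k, hk, Or.inl rfl⟩, by simp, by simp⟩,
      Or.inr ⟨0, smallEntry_of_le (Nat.zero_le ℓ), Or.inr ⟨?_, ?_⟩⟩⟩
    · simp only [gameK, Set.mem_ofPred_eq] at h
      omega
    · simp [TakeAwayGame.play]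
    · simp only [TakeAwayGame.play, hzero]
      omega

/-- Both entries being small, their partners lie too far up to be reached by changing one
coordinate; along the diagonal, the difference determines the pair. -/
theorem isWinningMove_diagonal_iff {ℓ i k : ℕ} (hk : 0 < k) (hi : SmallEntry ℓ i)
    (hik : SmallEntry ℓ (i + k)) (hpk : SmallEntry ℓ (partner ℓ i + k)) (m : ℕ × ℕ) :
    (gameK ℓ).IsWinningMove (i + k + (ℓ + 1), partner ℓ i + k + (ℓ + 1)) m ↔ m = (k, k) := by
  have hlt := add_lt_partner ℓ i
  rw [isWinningMove_iff]
  constructor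
  · rintro ⟨⟨-, ⟨t, ht, hm⟩, h1, h2⟩, hq | ⟨c, hc, ⟨hq1, hq2⟩ | ⟨hq1, hq2⟩⟩⟩ <;>
      try have hltc := add_lt_partner ℓ c
    all_goals rcases hm with rfl | rfl | rfl <;> simp only [TakeAwayGame.play] at *
    · omega
    · omega
    · omega
    · rw [show partner ℓ i + k = partner ℓ c by omega] at hpk
      exact absurd hpk hc.not_small_partner
    · obtain rfl : c = i + k := by omega
      have := partner_add_le ℓ i k
      omega
    · have := partner_eq_of_diff_eq hi hc (by omega)
      rw [Prod.mk.injEq]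
      omega
    · omega
    · rw [show i + k = partner ℓ c by omega] at hik
      exact absurd hik hc.not_small_partner
    · omega
  · rintro rfl
    refine ⟨⟨fun h => ?_, ⟨k, hk, Or.inr (Or.inr rfl)⟩, ?_, ?_⟩,
      Or.inr ⟨i, hi, Or.inl ⟨?_, ?_⟩⟩⟩
    · simp only [gameK, Set.mem_ofPred_eq] at h
      omega
    all_goals simp only [TakeAwayGame.play]; omega

theorem exists_unique_winningMove (ℓ : ℕ) {m : ℕ × ℕ} (hm : m ∈ wythoffMoves) :
    ∃ p, ∀ m', (gameK ℓ).IsWinningMove p m' ↔ m' = m := by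
  obtain ⟨k, hk, rfl | rfl | rfl⟩ := hm
  · exact ⟨_, isWinningMove_horizontal_iff hk⟩
  · refine ⟨(ℓ + 1, 2 * (ℓ + 1) + k), fun m' => ?_⟩
    rw [← isWinningMove_swap_iff]
    refine (isWinningMove_horizontal_iff hk m'.swap).trans ?_
    rw [← Prod.swap_inj (p := m')]
    rfl
  · obtain ⟨i, hi, hik, hpk⟩ := exists_small_add_small (ℓ := ℓ) hk
    exact ⟨_, isWinningMove_diagonal_iff hk hi hik hpk⟩

/-! ### From unique winning moves to non-redundancy -/

namespace TakeAwayGame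

theorem IsWinningMove.isNPosition {G : TakeAwayGame} {p m : ℕ × ℕ} (h : G.IsWinningMove p m) :
    G.IsNPosition p :=
  fun hp => (G.isPPosition_iff p).mp hp m h.1 h.2

theorem not_isRedundant_of_unique_winningMove {G : TakeAwayGame} {p m : ℕ × ℕ}
    (h : ∀ m', G.IsWinningMove p m' ↔ m' = m) : ¬ G.IsRedundant m := by
  rintro ⟨-, hred⟩
  have hP : ∀ q, (G.removeMove m).IsPPosition q ↔ G.IsPPosition q := fun q => Set.ext_iff.mp hred q
  refine ((h m).mpr rfl).isNPosition ((hP p).mp ?_)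
  rw [isPPosition_iff]
  rintro m' ⟨hterm, ⟨hmem, hne⟩, hle⟩ hq
  exact hne ((h m').mp ⟨⟨hterm, hmem, hle⟩, (hP _).mp hq⟩)

end TakeAwayGame

theorem mainTheorem10 (ℓ : ℕ) (hℓ : ℓ = 1 ∨ ℓ = 2 ∨ ℓ = 3 ∨ ℓ = 4) :
    ∀ m ∈ (gameK ℓ).moves,
      ¬ (gameK ℓ).IsRedundant m ∧
      ∃ p : ℕ × ℕ, (gameK ℓ).IsNPosition p ∧
        ∀ m' : ℕ × ℕ, (gameK ℓ).IsWinningMove p m' ↔ m' = m := by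
  intro m hm
  obtain ⟨p, hp⟩ := exists_unique_winningMove ℓ hm
  exact ⟨TakeAwayGame.not_isRedundant_of_unique_winningMove hp, p,
    ((hp m).mpr rfl).isNPosition, hp⟩
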